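/- Let $p$ be a prime, let $k$ be a field of characteristic $p$, and let $K/k$ be a purely inseparable extension. An extension $E/F$ of fields of characteristic $p$ is called *modular* if for every $n\in\mathbb{N}$ the subfields $E^{p^n}$ and $F$ of $E$ are linearly disjoint over $E^{p^n}\cap F$; $K/k$ is called *relatively perfect* if $k(K^p)=K$. For $n\in\mathbb N$ write $k^{p^{-n}}\cap K=\{x\in K : x^{p^n}\in k\}$. Assume that $K/k$ is relatively perfect and modular. Let $L$ be an intermediate field of $K/k$ with $L\neq k$ and $L\neq K$ such that $L/k$ is finite and $K/L$ is modular, and let $e=\min\{m\in\mathbb{N} : L^{p^m}\subseteq k\}$ be the exponent of $L/k$ (so $e\ge 1$). Then for every integer $n>e$ the field $k(L^{p^{e-1}})$ is contained in $k^{p^{-n}}\cap K$, and the extension $\left(k^{p^{-n}}\cap K\right)/k(L^{p^{e-1}})$ is modular. Consequently $K/k(L^{p^{e-1}})$ is modular. -/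

import Mathlib

/-- `K / k` is relatively perfect: `k(K^p) = K`. -/
def IsRelativelyPerfect (p : ℕ) (k K : Type*) [Field k] [Field K] [Algebra k K] : Prop :=
  IntermediateField.adjoin k (Set.range fun x : K => x ^ p) = ⊤

/-- Two subfields `A`, `B` of a field `E` are linearly disjoint over their intersection `A ∩ B`. -/
def LinearlyDisjointOverInf {E : Type*} [Field E] (A B : Subfield E) : Prop :=
  (Subfield.extendScalars (inf_le_left : A ⊓ B ≤ A)).LinearDisjoint
    (Subfield.extendScalars (inf_le_right : A ⊓ B ≤ B))

/-- The extension `K / k` in characteristic `p` is modular: for every `n`, the subfields `K^(p^n)`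
and (the image of) `k` of `K` are linearly disjoint over their intersection. -/
def IsModularExtension (p : ℕ) (k K : Type*) [Field k] [Field K] [Algebra k K] [ExpChar K p] :
    Prop :=
  ∀ n : ℕ, LinearlyDisjointOverInf (iterateFrobenius K p n).fieldRange (algebraMap k K).fieldRange

/-- The intermediate field `k^(p^(-n)) ∩ K` of `K / k`, that is, `{x ∈ K | x^(p^n) ∈ k}`. -/
def rootField (p : ℕ) (k K : Type*) [Field k] [Field K] [Algebra k K] [ExpChar K p] (n : ℕ) :
    IntermediateField k K :=
  ((algebraMap k K).fieldRange.comap (iterateFrobenius K p n)).toIntermediateField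
    fun x => ⟨x ^ p ^ n, by simp [iterateFrobenius_def]⟩

theorem mem_rootField_iff (p : ℕ) (k K : Type*) [Field k] [Field K] [Algebra k K] [ExpChar K p]
    (n : ℕ) (x : K) : x ∈ rootField p k K n ↔ ∃ a : k, algebraMap k K a = x ^ p ^ n :=
  Iff.rfl

/-- The intermediate field `k(L^(p^i))` of `K / k`, for an intermediate field `L`. -/
def adjoinPow (p : ℕ) {k K : Type*} [Field k] [Field K] [Algebra k K]
    (L : IntermediateField k K) (i : ℕ) : IntermediateField k K :=
  IntermediateField.adjoin k ((fun x : K => x ^ p ^ i) '' (L : Set K))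

/-! Put `A = K^(p^m)`. Relative perfectness iterates to `k(A) = K`; if `A` and `L` are linearly
disjoint, this forces `L = k(A ∩ L)` (`le_adjoin_inf`). Such generation passes to `M = k(L^(p^i))`,
since `A` is closed under powers, and modularity of `K/k` turns it back into linear disjointness of
`A` and `M` (`of_le_adjoin_inf`). So `K/M` is modular for every `i`. For `i = e - 1` also `M^p ⊆ k`,
which lets modularity descend from `K` to the root field; the final "consequently" is thus proved
first. -/

namespace LinearlyDisjointOverInf

variable {E : Type*} [Field E] {A B : Subfield E}

/-- Independence over the intersection of a family in the second subfield implies independence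
over the first one. -/
theorem linearIndependent (h : LinearlyDisjointOverInf A B) {ι : Type*} {v : ι → E}
    (hv : ∀ i, v i ∈ B) (hi : LinearIndependent ↥(A ⊓ B) v) : LinearIndependent A v := by
  have hi' : LinearIndependent ↥(A ⊓ B) (fun i => (⟨v i, hv i⟩ :
      ↥(Subfield.extendScalars (inf_le_right : A ⊓ B ≤ B)))) :=
    LinearIndependent.of_comp (Subfield.extendScalars
      (inf_le_right : A ⊓ B ≤ B)).val.toLinearMap hi
  exact h.linearIndependent_right hi'

/-- A spanning family of the second subfield over the intersection that is independent over the
first subfield witnesses linear disjointness. -/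
theorem of_span {ι : Type*} {v : ι → E} (hv : ∀ i, v i ∈ B) (hi : LinearIndependent A v)
    (hs : ∀ z ∈ B, z ∈ Submodule.span ↥(A ⊓ B) (Set.range v)) :
    LinearlyDisjointOverInf A B := by
  let B' := Subfield.extendScalars (inf_le_right : A ⊓ B ≤ B)
  let w : ι → B' := fun i => ⟨v i, hv i⟩
  have hi' : LinearIndependent ↥(A ⊓ B) v :=
    hi.map_of_injective_injective (Subfield.inclusion (inf_le_left : A ⊓ B ≤ A))
      (AddMonoidHom.id E) (fun r hr => by simpa using hr) (fun _ hr => hr) (fun _ _ => rfl)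
  have hw : LinearIndependent ↥(A ⊓ B) w := LinearIndependent.of_comp B'.val.toLinearMap hi'
  have hsp : ⊤ ≤ Submodule.span ↥(A ⊓ B) (Set.range w) := by
    rintro ⟨z, hz⟩ -
    have h1 : z ∈ (Submodule.span ↥(A ⊓ B) (Set.range w)).map B'.val.toLinearMap := by
      rw [Submodule.map_span, ← Set.range_comp]
      exact hs z hz
    obtain ⟨y, hy, rfl⟩ := h1
    exact hy
  refine IntermediateField.LinearDisjoint.of_basis_right (Module.Basis.mk hw hsp) ?_
  rw [Module.Basis.coe_mk]
  exact hi

theorem of_le (h : A ≤ B) : LinearlyDisjointOverInf A B := by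
  have : Subfield.extendScalars (inf_le_left : A ⊓ B ≤ A) = ⊥ := by
    refine le_antisymm (fun x hx => ?_) bot_le
    exact IntermediateField.mem_bot.2 ⟨⟨x, hx, h hx⟩, rfl⟩
  rw [LinearlyDisjointOverInf, this]
  exact IntermediateField.LinearDisjoint.bot_left _ _ _

theorem exists_span (h : LinearlyDisjointOverInf A B) : ∃ s : Set E, s ⊆ B ∧
    LinearIndependent A ((↑) : s → E) ∧ LinearIndependent ↥(A ⊓ B) ((↑) : s → E) ∧
    ∀ z ∈ B, z ∈ Submodule.span ↥(A ⊓ B) s := by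
  obtain ⟨s, hsB, hs, hi⟩ := exists_linearIndependent ↥(A ⊓ B) (B : Set E)
  exact ⟨s, hsB, h.linearIndependent (fun i => hsB i.2) hi, hi,
    fun z hz => hs ▸ Submodule.subset_span hz⟩

/-- The first subfield may be shrunk as long as the intersection is not. -/
theorem mono_left (h : LinearlyDisjointOverInf A B) {A' : Subfield E} (h₁ : A' ≤ A)
    (h₂ : A ⊓ B ≤ A') : LinearlyDisjointOverInf A' B := by
  obtain ⟨s, hsB, hi, -, hs⟩ := h.exists_span
  have heq : A' ⊓ B = A ⊓ B :=
    le_antisymm (inf_le_inf_right _ h₁) (le_inf h₂ inf_le_right)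
  refine of_span (v := ((↑) : s → E)) (fun i => hsB i.2) ?_ ?_
  · exact hi.map_of_injective_injective (Subfield.inclusion h₁)
      (AddMonoidHom.id E) (fun r hr => by simpa using hr) (fun _ hr => hr) (fun _ _ => rfl)
  · rw [heq]
    simpa using hs

/-- Linear disjointness is reflected by field embeddings. -/
theorem of_map {E' : Type*} [Field E'] (f : E →+* E')
    (h : LinearlyDisjointOverInf (A.map f) (B.map f)) : LinearlyDisjointOverInf A B := by
  obtain ⟨s, hsB, hs, hi⟩ := exists_linearIndependent ↥(A ⊓ B) (B : Set E)
  refine of_span (v := ((↑) : s → E)) (fun i => hsB i.2) ?_ ?_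
  · have hsurj : ∀ r : ↥(A.map f ⊓ B.map f), ∃ a : ↥(A ⊓ B), f a = r := by
      rintro ⟨r, ⟨a, ha, rfl⟩, b, hb, hab⟩
      obtain rfl := f.injective hab
      exact ⟨⟨b, ha, hb⟩, rfl⟩
    choose g hg using hsurj
    have h1 : LinearIndependent ↥(A.map f ⊓ B.map f) (fun i : s => f i) :=
      hi.map_of_injective_injective g f.toAddMonoidHom
        (fun r hr => by ext; rw [← hg r, hr]; simp)
        (fun m hm => f.injective (hm.trans f.map_zero.symm))
        (fun r m => by
          simp only [Subfield.smul_def, smul_eq_mul, RingHom.toAddMonoidHom_eq_coe,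
            AddMonoidHom.coe_coe, map_mul, hg])
    have h2 := h.linearIndependent (fun i : s => ⟨(i : E), hsB i.2, rfl⟩) h1
    rw [linearIndependent_iff'] at h2 ⊢
    intro t c hc i hi
    have h3 := h2 t (fun i => ⟨f (c i), c i, (c i).2, rfl⟩)
      (by simpa [Subfield.smul_def] using congrArg f hc) i hi
    ext
    exact f.injective ((congrArg Subtype.val h3).trans f.map_zero.symm)
  · rw [Subtype.range_coe, hs]
    exact fun z hz => Submodule.subset_span hz

end LinearlyDisjointOverInf

/-! ### Generation by Frobenius images and transfer of modularity. -/

section Tower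

variable {k K : Type*} [Field k] [Field K] [Algebra k K]

/-- By algebraicity `k(F)` is the ring `k[F]`, and products of elements of `F` stay in `F`. -/
theorem mem_span_range_of_mem_adjoin [Algebra.IsAlgebraic k K] {F : Subfield K} {z : K}
    (hz : z ∈ IntermediateField.adjoin k (F : Set K)) :
    z ∈ Submodule.span F (Set.range (algebraMap k K)) := by
  rw [← IntermediateField.mem_toSubalgebra,
    IntermediateField.adjoin_toSubalgebra_of_isAlgebraic
      (fun x _ => Algebra.IsAlgebraic.isAlgebraic x), ← Subalgebra.mem_toSubmodule,
    Algebra.adjoin_eq_span,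
    show Submonoid.closure (F : Set K) = F.toSubring.toSubsemiring.toSubmonoid from
      Submonoid.closure_eq F.toSubring.toSubsemiring.toSubmonoid] at hz
  rw [← Submodule.mem_toAddSubmonoid, Submodule.span_eq_closure] at hz ⊢
  refine AddSubmonoid.closure_mono ?_ hz
  rintro _ ⟨a, -, x, hx, rfl⟩
  refine ⟨⟨x, hx⟩, trivial, algebraMap k K a, ⟨a, rfl⟩, ?_⟩
  simp only [Algebra.smul_def]
  exact mul_comm _ _

theorem mem_adjoin_of_mem_span_range {F : Subfield K} {z : K}
    (hz : z ∈ Submodule.span F (Set.range (algebraMap k K))) :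
    z ∈ IntermediateField.adjoin k (F : Set K) := by
  induction hz using Submodule.span_induction with
  | mem x hx => obtain ⟨a, rfl⟩ := hx; exact algebraMap_mem _ a
  | zero => exact zero_mem _
  | add x y _ _ hx hy => exact add_mem hx hy
  | smul a x _ hx => exact mul_mem (IntermediateField.subset_adjoin k _ a.2) hx

/-- If `k(A) = K` and `A`, `L` are linearly disjoint over `A ∩ L`, then `L = k(A ∩ L)`. -/
theorem LinearlyDisjointOverInf.le_adjoin_inf [Algebra.IsAlgebraic k K] {A : Subfield K}
    {L : IntermediateField k K} (h : LinearlyDisjointOverInf A L.toSubfield)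
    (hA : IntermediateField.adjoin k (A : Set K) = ⊤) :
    L ≤ IntermediateField.adjoin k (↑(A ⊓ L.toSubfield) : Set K) := by
  intro z hz
  apply mem_adjoin_of_mem_span_range
  by_contra hzs
  -- Adding `z` to a basis `s` of the `A ∩ L`-span of `k` keeps it independent, hence independent
  -- over `A`; but `k(A) = K` puts `z` in the `A`-span of `s`.
  obtain ⟨s, hsk, hs, hi⟩ :=
    exists_linearIndependent ↥(A ⊓ L.toSubfield) (Set.range (algebraMap k K))
  rw [← hs] at hzs
  have hi2 : LinearIndepOn ↥(A ⊓ L.toSubfield) id (insert z s) :=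
    LinearIndepOn.insert (v := id) hi (by simpa using hzs)
  have hi3 : LinearIndepOn A id (insert z s) := by
    refine h.linearIndependent ?_ hi2
    rintro ⟨x, rfl | hx⟩
    · exact hz
    · obtain ⟨a, rfl⟩ := hsk hx
      exact L.algebraMap_mem a
  have hzs' : z ∉ s := fun hh => hzs (Submodule.subset_span hh)
  rw [linearIndepOn_insert hzs'] at hi3
  refine hi3.2 ?_
  have hzA : z ∈ Submodule.span A (Set.range (algebraMap k K)) :=
    mem_span_range_of_mem_adjoin (hA ▸ IntermediateField.mem_top)
  rw [Set.image_id, id]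
  refine Submodule.span_le.2 (fun x hx => ?_) hzA
  have hx' : x ∈ Submodule.span ↥(A ⊓ L.toSubfield) s := hs ▸ Submodule.subset_span hx
  clear hx
  induction hx' using Submodule.span_induction with
  | mem x hx => exact Submodule.subset_span hx
  | zero => exact zero_mem _
  | add x y _ _ hx hy => exact add_mem hx hy
  | smul a x _ hx => exact Submodule.smul_mem _ (⟨a, a.2.1⟩ : A) hx

/-- If `A`, `k` are linearly disjoint over `A ∩ k` and `M = k(A ∩ M)`, then `A`, `M` are linearly
disjoint over `A ∩ M`. -/
theorem LinearlyDisjointOverInf.of_le_adjoin_inf [Algebra.IsAlgebraic k K] {A : Subfield K}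
    {M : IntermediateField k K} (h : LinearlyDisjointOverInf A (algebraMap k K).fieldRange)
    (hM : M ≤ IntermediateField.adjoin k (↑(A ⊓ M.toSubfield) : Set K)) :
    LinearlyDisjointOverInf A M.toSubfield := by
  -- A basis of `k` over `A ∩ k` is `A`-independent and spans `M = k(A ∩ M)` over `A ∩ M`.
  obtain ⟨s, hsk, hi, -, hs⟩ := h.exists_span
  have hle : (algebraMap k K).fieldRange ≤ M.toSubfield := by
    rintro _ ⟨a, rfl⟩
    exact M.algebraMap_mem a
  refine of_span (v := ((↑) : s → K)) (fun i => hle (hsk i.2)) hi fun z hz => ?_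
  rw [Subtype.range_coe]
  refine Submodule.span_le.2 (fun x hx => ?_) (mem_span_range_of_mem_adjoin (hM hz))
  have hx' := hs x hx
  clear hx
  induction hx' using Submodule.span_induction with
  | mem x hx => exact Submodule.subset_span hx
  | zero => exact zero_mem _
  | add x y _ _ hx hy => exact add_mem hx hy
  | smul a x _ hx =>
    exact Submodule.smul_mem _ (⟨a, a.2.1, hle a.2.2⟩ : ↥(A ⊓ M.toSubfield)) hx

theorem pow_mem_adjoinPow (p : ℕ) {L : IntermediateField k K} {x : K} (hx : x ∈ L) (i : ℕ) :
    x ^ p ^ i ∈ adjoinPow p L i :=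
  IntermediateField.subset_adjoin k _ ⟨x, hx, rfl⟩

theorem fieldRange_algebraMap_intermediateField (L : IntermediateField k K) :
    (algebraMap L K).fieldRange = L.toSubfield := by
  ext x
  exact ⟨fun ⟨y, hy⟩ => hy ▸ y.2, fun hx => ⟨⟨x, hx⟩, rfl⟩⟩

variable {p : ℕ} [ExpChar K p]

/-- To check that `x ^ p ^ n` lies in `M` for `x ∈ k(S)` it suffices to check it for `x ∈ S`. -/
theorem pow_mem_of_mem_adjoin {M : IntermediateField k K} {S : Set K} (n : ℕ)
    (hS : ∀ x ∈ S, x ^ p ^ n ∈ M) {x : K} (hx : x ∈ IntermediateField.adjoin k S) :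
    x ^ p ^ n ∈ M := by
  let N : IntermediateField k K := (M.toSubfield.comap (iterateFrobenius K p n)).toIntermediateField
    fun a => show algebraMap k K a ^ p ^ n ∈ M from pow_mem (M.algebraMap_mem a) _
  have : IntermediateField.adjoin k S ≤ N := IntermediateField.adjoin_le_iff.2 hS
  exact this hx

theorem IsRelativelyPerfect.adjoin_fieldRange (h : IsRelativelyPerfect p k K) (m : ℕ) :
    IntermediateField.adjoin k ((iterateFrobenius K p m).fieldRange : Set K) = ⊤ := by
  induction m with
  | zero =>
    refine top_le_iff.1 fun x _ => IntermediateField.subset_adjoin k _ ⟨x, ?_⟩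
    simp
  | succ m ih =>
    refine top_le_iff.1 (h.symm.le.trans (IntermediateField.adjoin_le_iff.2 ?_))
    rintro _ ⟨x, rfl⟩
    have hx : x ∈ IntermediateField.adjoin k ((iterateFrobenius K p m).fieldRange : Set K) :=
      ih ▸ IntermediateField.mem_top
    have := pow_mem_of_mem_adjoin (p := p) (M := IntermediateField.adjoin k
      ((iterateFrobenius K p (m + 1)).fieldRange : Set K)) 1 (fun y hy => ?_) hx
    · simpa using this
    · obtain ⟨y, rfl⟩ := hy
      refine IntermediateField.subset_adjoin k _ ⟨y, ?_⟩
      simp [iterateFrobenius_def, pow_succ, pow_mul]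

theorem adjoinPow_le_adjoin_inf {L : IntermediateField k K} {A : Subfield K} (i : ℕ)
    (h : L ≤ IntermediateField.adjoin k (↑(A ⊓ L.toSubfield) : Set K)) :
    adjoinPow p L i ≤
      IntermediateField.adjoin k (↑(A ⊓ (adjoinPow p L i).toSubfield) : Set K) := by
  refine IntermediateField.adjoin_le_iff.2 ?_
  rintro _ ⟨x, hx, rfl⟩
  refine pow_mem_of_mem_adjoin i (fun y hy => ?_) (h hx)
  exact IntermediateField.subset_adjoin k _ ⟨pow_mem hy.1 _, pow_mem_adjoinPow p hy.2 i⟩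

/-- If `K/k` is relatively perfect and modular and `K/L` is modular, then `K/k(L^(p^i))` is
modular for every `i`. -/
theorem isModularExtension_adjoinPow [Algebra.IsAlgebraic k K] (hperf : IsRelativelyPerfect p k K)
    (hmod : IsModularExtension p k K) {L : IntermediateField k K} (hL : IsModularExtension p L K)
    (i : ℕ) : IsModularExtension p (adjoinPow p L i) K := by
  intro m
  have hLm := hL m
  rw [fieldRange_algebraMap_intermediateField] at hLm ⊢
  exact (hmod m).of_le_adjoin_inf
    (adjoinPow_le_adjoin_inf i (hLm.le_adjoin_inf (hperf.adjoin_fieldRange m)))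

theorem rootField_mono {m n : ℕ} (h : m ≤ n) : rootField p k K m ≤ rootField p k K n := by
  intro x hx
  rw [mem_rootField_iff] at hx ⊢
  obtain ⟨a, ha⟩ := hx
  refine ⟨a ^ p ^ (n - m), ?_⟩
  rw [map_pow, ha, ← pow_mul, ← pow_add, Nat.add_sub_cancel' h]

/-- If `K/M` is modular with `M^p ⊆ k`, then `(k^(p^(-n)) ∩ K)/M` is modular. -/
theorem IsModularExtension.rootField {M : IntermediateField k K} (hM : IsModularExtension p M K)
    (h₁ : M ≤ rootField p k K 1) {n : ℕ} (h : M ≤ rootField p k K n) :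
    IsModularExtension p M (IntermediateField.extendScalars h) := by
  intro m
  let f : IntermediateField.extendScalars h →+* K :=
    (IntermediateField.extendScalars h).val.toRingHom
  refine LinearlyDisjointOverInf.of_map f ?_
  have hB : (algebraMap M (IntermediateField.extendScalars h)).fieldRange.map f =
      M.toSubfield := by
    rw [← fieldRange_algebraMap_intermediateField, RingHom.map_fieldRange]
    rfl
  have hAmem : ∀ x, x ∈ (iterateFrobenius (IntermediateField.extendScalars h) p m).fieldRange.map f
      ↔ ∃ y ∈ _root_.rootField p k K n, y ^ p ^ m = x := by
    intro x
    constructor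
    · rintro ⟨_, ⟨y, rfl⟩, rfl⟩
      exact ⟨y, y.2, by simp [iterateFrobenius_def, f]⟩
    · rintro ⟨y, hy, rfl⟩
      exact ⟨_, ⟨⟨y, hy⟩, rfl⟩, by simp [iterateFrobenius_def, f]⟩
  rw [hB]
  rcases lt_or_ge m n with hmn | hmn
  · have hK := hM m
    rw [fieldRange_algebraMap_intermediateField] at hK
    refine hK.mono_left ?_ ?_
    · intro x hx
      obtain ⟨y, -, rfl⟩ := (hAmem x).1 hx
      exact ⟨y, rfl⟩
    -- From `y^(p^m) ∈ M` and `M^p ⊆ k` follows `y^(p^(m+1)) ∈ k`, and `m + 1 ≤ n`.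
    · rintro _ ⟨⟨y, rfl⟩, hy⟩
      refine (hAmem _).2 ⟨y, rootField_mono (Nat.succ_le_of_lt hmn) ?_, rfl⟩
      obtain ⟨a, ha⟩ := (mem_rootField_iff ..).1 (h₁ hy)
      refine (mem_rootField_iff ..).2 ⟨a, ?_⟩
      rw [ha, iterateFrobenius_def, ← pow_mul, ← pow_add]
  -- For `m ≥ n` the `p^m`-th powers of the root field already lie in `k`.
  · refine LinearlyDisjointOverInf.of_le fun x hx => ?_
    obtain ⟨y, hy, rfl⟩ := (hAmem x).1 hx
    obtain ⟨a, ha⟩ := (mem_rootField_iff ..).1 (rootField_mono hmn hy)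
    exact ha ▸ M.algebraMap_mem a

end Tower

theorem mainTheorem4 (p : ℕ) [Fact p.Prime] (k K : Type*) [Field k] [Field K] [Algebra k K]
    [CharP k p] [CharP K p] [IsPurelyInseparable k K]
    (hperf : IsRelativelyPerfect p k K) (hmod : IsModularExtension p k K)
    (L : IntermediateField k K) [FiniteDimensional k L] (hbot : L ≠ ⊥) (htop : L ≠ ⊤)
    (hL : IsModularExtension p L K)
    (e : ℕ) (he : e = IsPurelyInseparable.exponent k L) :
    (∀ n : ℕ, e < n → ∃ h : adjoinPow p L (e - 1) ≤ rootField p k K n,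
      IsModularExtension p (adjoinPow p L (e - 1)) (IntermediateField.extendScalars h)) ∧
    IsModularExtension p (adjoinPow p L (e - 1)) K := by
  have hM := isModularExtension_adjoinPow hperf hmod hL (e - 1)
  have h₁ : adjoinPow p L (e - 1) ≤ rootField p k K 1 := by
    refine IntermediateField.adjoin_le_iff.2 ?_
    rintro _ ⟨x, hx, rfl⟩
    obtain ⟨a, ha⟩ := IsPurelyInseparable.exponent_def' k p (⟨x, hx⟩ : L)
    rw [← he] at ha
    have hxe : x ∈ rootField p k K e := (mem_rootField_iff ..).2
      ⟨a, by simpa using congrArg (algebraMap L K) ha⟩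
    obtain ⟨b, hb⟩ := (mem_rootField_iff ..).1
      -- As an inequality this survives truncated subtraction, so `e ≥ 1` need not be proved.
      (rootField_mono (show e ≤ e - 1 + 1 by omega) hxe)
    exact (mem_rootField_iff ..).2 ⟨b, by rw [hb, ← pow_mul, ← pow_add]⟩
  exact ⟨fun n hn => ⟨h₁.trans (rootField_mono (by omega)), hM.rootField h₁ _⟩, hM⟩
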